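/- Let $k$ be a field, let $d\ge 5$ be an integer, and let $H=\langle d+1,d+2,2d+1\rangle=\{c_1(d+1)+c_2(d+2)+c_3(2d+1)\mid c_1,c_2,c_3\in\mathbb Z_{\ge 0}\}$. Let $\mathrm F(H)$ be the Frobenius number of $H$, that is, the largest element of $\mathbb N\setminus H$. Let $R=k[[H]]=k[[t^{d+1},t^{d+2},t^{2d+1}]]\subseteq k[[t]]$, and let $I\subseteq k[[x,y,z]]$ be the defining ideal of $R$, that is, the kernel of the $k$-algebra homomorphism $\varphi:k[[x,y,z]]\to R$ given by the substitution $\varphi(x)=t^{d+1}$, $\varphi(y)=t^{d+2}$, $\varphi(z)=t^{2d+1}$. For a matrix $M$ over $k[[x,y,z]]$ write $\mathrm I_2(M)$ for the ideal generated by the $2\times 2$ minors of $M$. Then the following hold. 1) If $d\equiv 0\pmod 3$, then $I=\mathrm I_2\begin{pmatrix} y & z^{d/3} & x\\ x^2 & y^{2d/3} & z\end{pmatrix}$ and $\mathrm F(H)=\frac23 d^2+\frac13 d-1$. 2) If $d\equiv 1\pmod 3$, then $I=\mathrm I_2\begin{pmatrix} y & z^{(d+2)/3} & x^3\\ 1 &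 y^{(2d-2)/3} & z\end{pmatrix}$ and $\mathrm F(H)=\frac23 d^2+\frac23 d-\frac13$. 3) If $d\equiv 2\pmod 3$, then $I=\mathrm I_2\begin{pmatrix} y & z^{(d+1)/3} & x^2\\ x & y^{(2d-1)/3} & z\end{pmatrix}$ and $\mathrm F(H)=\frac23 d^2-\frac23$. -/

import Mathlib

open scoped PowerSeries

noncomputable section

namespace NumSemigroup

/-- The submonoid `⟨n_1, …, n_e⟩` of `ℕ` generated by the `n_i`. -/
def semigroup {e : ℕ} (n : Fin e → ℕ) : AddSubmonoid ℕ :=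
  AddSubmonoid.closure (Set.range n)

/-- The semigroup ring `k[[H]] ⊆ k[[t]]`: the power series in `t` all of whose exponents lie
in `H`. For `H = ⟨n_1, …, n_e⟩` with positive `n_i` this is `k[[t^{n_1}, …, t^{n_e}]]`. -/
def semigroupRing (k : Type*) [Field k] (H : AddSubmonoid ℕ) : Subalgebra k k⟦X⟧ where
  carrier := {f | ∀ m, m ∉ H → PowerSeries.coeff m f = 0}
  mul_mem' := by
    intro f g hf hg m hm
    rw [PowerSeries.coeff_mul]
    refine Finset.sum_eq_zero fun p hp => ?_
    rw [Finset.HasAntidiagonal.mem_antidiagonal] at hp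
    by_cases h1 : p.1 ∈ H
    · have h2 : p.2 ∉ H := fun h2 => hm (hp ▸ H.add_mem h1 h2)
      rw [hg _ h2, mul_zero]
    · rw [hf _ h1, zero_mul]
  add_mem' := by
    intro f g hf hg m hm
    rw [map_add, hf m hm, hg m hm, add_zero]
  algebraMap_mem' := by
    intro r m hm
    have h0 : m ≠ 0 := fun h => hm (h ▸ H.zero_mem)
    rw [PowerSeries.algebraMap_apply, PowerSeries.coeff_C, if_neg h0]

theorem hasSubst_pow (k : Type*) [Field k] {e : ℕ} (n : Fin e → ℕ) (hn : ∀ i, 0 < n i) :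
    MvPowerSeries.HasSubst (fun i => (PowerSeries.X ^ n i : k⟦X⟧)) := by
  refine MvPowerSeries.hasSubst_of_constantCoeff_zero fun i => ?_
  have h : PowerSeries.constantCoeff (PowerSeries.X ^ n i : k⟦X⟧) = 0 := by
    rw [map_pow, PowerSeries.constantCoeff_X, zero_pow (hn i).ne']
  exact h

theorem substAlgHom_mem (k : Type*) [Field k] {e : ℕ} (n : Fin e → ℕ) (hn : ∀ i, 0 < n i)
    (f : MvPowerSeries (Fin e) k) :
    MvPowerSeries.substAlgHom (R := k) (hasSubst_pow k n hn) f
      ∈ semigroupRing k (semigroup n) := by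
  intro m hm
  rw [MvPowerSeries.substAlgHom_apply, PowerSeries.coeff,
    MvPowerSeries.coeff_subst (hasSubst_pow k n hn)]
  refine finsum_eq_zero_of_forall_eq_zero fun d => ?_
  have hprod : (d.prod fun i c => (PowerSeries.X ^ n i : k⟦X⟧) ^ c)
      = PowerSeries.X ^ (d.sum fun i c => n i * c) := by
    simp only [Finsupp.prod, Finsupp.sum, ← pow_mul, Finset.prod_pow_eq_pow_sum]
  have hmem : (d.sum fun i c => n i * c) ∈ semigroup n := by
    refine AddSubmonoid.sum_mem _ fun i _ => ?_
    simpa only [semigroup, smul_eq_mul, mul_comm] using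
      AddSubmonoid.nsmul_mem _ (AddSubmonoid.subset_closure (Set.mem_range_self (f := n) i)) (d i)
  have hne : m ≠ d.sum fun i c => n i * c := fun h => hm (h ▸ hmem)
  have hc : PowerSeries.coeff m (d.prod fun i c => (PowerSeries.X ^ n i : k⟦X⟧) ^ c) = 0 := by
    rw [hprod, PowerSeries.coeff_X_pow, if_neg hne]
  exact (congrArg _ hc).trans (smul_zero _)

/-- The `k`-algebra homomorphism `φ : k[[x_1, …, x_e]] → k[[H]]`, `H = ⟨n_1, …, n_e⟩`, given by
substituting `t ^ n_i` for `x_i`. -/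
def presentation (k : Type*) [Field k] {e : ℕ} (n : Fin e → ℕ) (hn : ∀ i, 0 < n i) :
    MvPowerSeries (Fin e) k →ₐ[k] semigroupRing k (semigroup n) :=
  (MvPowerSeries.substAlgHom (R := k) (hasSubst_pow k n hn)).codRestrict _
    (substAlgHom_mem k n hn)

theorem presentation_X (k : Type*) [Field k] {e : ℕ} (n : Fin e → ℕ) (hn : ∀ i, 0 < n i)
    (i : Fin e) :
    (presentation k n hn (MvPowerSeries.X i) : k⟦X⟧) = PowerSeries.X ^ n i :=
  MvPowerSeries.substAlgHom_X (hasSubst_pow k n hn) i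

/-- The defining ideal `I = Ker φ` of `k[[H]]`. -/
def definingIdeal (k : Type*) [Field k] {e : ℕ} (n : Fin e → ℕ) (hn : ∀ i, 0 < n i) :
    Ideal (MvPowerSeries (Fin e) k) :=
  RingHom.ker (presentation k n hn)

/-- `I_t(M)`: the ideal generated by the `t × t` minors of the matrix `M`. -/
def minorIdeal {A : Type*} [CommRing A] {p q : ℕ} (t : ℕ) (M : Matrix (Fin p) (Fin q) A) :
    Ideal A :=
  Ideal.span {f | ∃ (r : Fin t ↪o Fin p) (c : Fin t ↪o Fin q), f = (M.submatrix r c).det}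

/-- The generators `d + 1, d + 2, 2d + 1`. -/
def gens (d : ℕ) : Fin 3 → ℕ := ![d + 1, d + 2, 2 * d + 1]

theorem gens_pos (d : ℕ) : ∀ i, 0 < gens d i := by
  intro i
  fin_cases i <;> simp [gens]

/-- The variables of `k[[x, y, z]]`. -/
def x (k : Type*) [Field k] : MvPowerSeries (Fin 3) k := MvPowerSeries.X 0
def y (k : Type*) [Field k] : MvPowerSeries (Fin 3) k := MvPowerSeries.X 1
def z (k : Type*) [Field k] : MvPowerSeries (Fin 3) k := MvPowerSeries.X 2

end NumSemigroup

end

/-!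
The three matrices are instances of one `2 × 3` matrix
`(y, z ^ q, x ^ β; x ^ α, y ^ s, z)` with `α + β = 3`, `3 s + 2 = α + 2 d` and `s + q = d`.
Its minors are the binomials `y ^ (s + 1) - x ^ α z ^ q`, `y z - x ^ 3` and
`z ^ (q + 1) - x ^ β y ^ s`, which are homogeneous when `x, y, z` are given the weights
`d + 1, d + 2, 2 d + 1`; hence they lie in the kernel of the presentation.

Used as rewriting rules, the binomials bring every monomial to a normal form `x ^ a y ^ b z ^ c`
with `b ≤ s`, `c ≤ q` and `b = 0` or `c = 0` (`IsNormal.of_rewriting`). A normal form is determined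
by its weight, because the weight is congruent to `b - c ∈ [-q, s]` modulo `d + 1 = s + q + 1`
(`IsNormal.eq_of_weight_eq`). So two monomials of the same weight are congruent modulo the ideal
of minors.

A power series lies in the kernel exactly when, for every `N`, its coefficients at the monomials
of weight `N` sum to zero (`coeff_presentation`). Then each of its weighted homogeneous components
is a combination of differences of monomials of equal weight, and lies in the ideal of minors.
There is no convergence problem in passing from the components to the series: since the generators
are homogeneous, the coefficients of the multipliers can be copied weight by weight from those
for the components (`mem_span_range_of_weightedHomogeneousComponent_mem`).

The same normal forms describe the semigroup: they show that
`{b (d + 2) | b ≤ s} ∪ {c (2 d + 1) | c ≤ q}` is the Apéry set of `H` with respect to `d + 1`, and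
the Frobenius number is its largest element minus `d + 1` (`frobeniusNumber_gens`).
-/

namespace NumSemigroup

/-! ### Ideals of power series generated by weighted homogeneous elements -/

/-- A power series belongs to an ideal generated by finitely many weighted homogeneous series as
soon as all its weighted homogeneous components do. -/
theorem mem_span_range_of_weightedHomogeneousComponent_mem {σ ι R : Type*} [CommRing R] [Fintype ι]
    {w : σ → ℕ} {g : ι → MvPowerSeries σ R} {D : ι → ℕ}
    (hg : ∀ i, (g i).IsWeightedHomogeneous w (D i)) {f : MvPowerSeries σ R}
    (hf : ∀ N, f.weightedHomogeneousComponent w N ∈ Ideal.span (Set.range g)) :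
    f ∈ Ideal.span (Set.range g) := by
  classical
  simp only [Ideal.mem_span_range_iff_exists_fun] at hf ⊢
  choose a ha using hf
  -- In the coefficient of `A i * g i` at `e`, only coefficients of `A i` at exponents `m` with
  -- `weight m + D i = weight e` matter; these are the ones of `a (weight e) i`.
  let A : ι → MvPowerSeries σ R := fun i m =>
    MvPowerSeries.coeff m (a (Finsupp.weight w m + D i) i)
  have hA : ∀ i m, MvPowerSeries.coeff m (A i) =
      MvPowerSeries.coeff m (a (Finsupp.weight w m + D i) i) := fun _ _ => rfl
  refine ⟨A, ?_⟩
  ext e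
  have he := congrArg (MvPowerSeries.coeff e) (ha (Finsupp.weight w e))
  rw [MvPowerSeries.coeff_weightedHomogeneousComponent, if_pos rfl] at he
  rw [← he, map_sum, map_sum]
  refine Finset.sum_congr rfl fun i _ => ?_
  rw [MvPowerSeries.coeff_mul, MvPowerSeries.coeff_mul]
  refine Finset.sum_congr rfl fun m hm => ?_
  by_cases h : Finsupp.weight w m.2 = D i
  · rw [hA, ← h, ← map_add, Finset.HasAntidiagonal.mem_antidiagonal.mp hm]
  · rw [MvPowerSeries.IsWeightedHomogeneous.coeff_eq_zero (hg i) h, mul_zero, mul_zero]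

/-- The coefficient of `t ^ N` in `φ f` is the sum of the coefficients of `f` at the monomials of
weight `N`. -/
theorem coeff_presentation (k : Type*) [Field k] {e : ℕ} (n : Fin e → ℕ) (hn : ∀ i, 0 < n i)
    (f : MvPowerSeries (Fin e) k) (N : ℕ) :
    PowerSeries.coeff N (presentation k n hn f : k⟦X⟧) =
      ∑ m ∈ (Finsupp.finite_of_nat_weight_eq n (fun i => (hn i).ne') N).toFinset,
        MvPowerSeries.coeff m f := by
  have hprod : ∀ m : Fin e →₀ ℕ, (m.prod fun i c => (PowerSeries.X ^ n i : k⟦X⟧) ^ c)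
      = PowerSeries.X ^ (Finsupp.weight n m) := fun m => by
    simp only [Finsupp.weight_apply, Finsupp.prod, Finsupp.sum, ← pow_mul,
      Finset.prod_pow_eq_pow_sum, smul_eq_mul, mul_comm]
  have hcoeff : ∀ m : Fin e →₀ ℕ,
      PowerSeries.coeff N (m.prod fun i c => (PowerSeries.X ^ n i : k⟦X⟧) ^ c) =
        if N = Finsupp.weight n m then 1 else 0 := fun m => by
    rw [hprod, PowerSeries.coeff_X_pow]
  change PowerSeries.coeff N (MvPowerSeries.substAlgHom (R := k) (hasSubst_pow k n hn) f) = _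
  rw [MvPowerSeries.substAlgHom_apply, PowerSeries.coeff,
    MvPowerSeries.coeff_subst (hasSubst_pow k n hn), ← PowerSeries.coeff]
  simp only [hcoeff]
  rw [finsum_eq_sum_of_support_subset]
  · refine Finset.sum_congr rfl fun m hm => ?_
    rw [Set.Finite.mem_toFinset, Set.mem_ofPred_eq] at hm
    rw [if_pos hm.symm, smul_eq_mul, mul_one]
  · intro m hm
    rw [Set.Finite.coe_toFinset, Set.mem_ofPred_eq]
    by_contra h
    exact hm ((congrArg _ (if_neg (Ne.symm h))).trans (smul_zero _))

/-- The defining ideal is contained in any ideal that is generated by finitely many weighted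
homogeneous series and identifies any two monomials of the same weight. -/
theorem definingIdeal_le_span_range (k : Type*) [Field k] {e : ℕ} (n : Fin e → ℕ)
    (hn : ∀ i, 0 < n i) {ι : Type*} [Fintype ι] {g : ι → MvPowerSeries (Fin e) k} {D : ι → ℕ}
    (hg : ∀ i, (g i).IsWeightedHomogeneous n (D i))
    (hmon : ∀ m m' : Fin e →₀ ℕ, Finsupp.weight n m = Finsupp.weight n m' →
      MvPowerSeries.monomial m (1 : k) - MvPowerSeries.monomial m' 1 ∈
        Ideal.span (Set.range g)) :
    definingIdeal k n hn ≤ Ideal.span (Set.range g) := by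
  classical
  intro f hf
  refine mem_span_range_of_weightedHomogeneousComponent_mem hg fun N => ?_
  set S := (Finsupp.finite_of_nat_weight_eq n (fun i => (hn i).ne') N).toFinset with hS
  have hmemS : ∀ m, m ∈ S ↔ Finsupp.weight n m = N := fun m => by
    rw [hS, Set.Finite.mem_toFinset, Set.mem_ofPred_eq]
  have hsum : ∑ m ∈ S, MvPowerSeries.coeff m f = 0 := by
    have h0 : presentation k n hn f = 0 := hf
    rw [hS, ← coeff_presentation k n hn, h0, ZeroMemClass.coe_zero, map_zero]
  have hcomp : f.weightedHomogeneousComponent n N =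
      ∑ m ∈ S, MvPowerSeries.monomial m (MvPowerSeries.coeff m f) := by
    ext m
    rw [MvPowerSeries.coeff_weightedHomogeneousComponent, map_sum]
    simp only [MvPowerSeries.coeff_monomial, Finset.sum_ite_eq, hmemS]
  rw [hcomp]
  rcases S.eq_empty_or_nonempty with h | ⟨m₀, hm₀⟩
  · rw [h, Finset.sum_empty]
    exact zero_mem _
  -- As the coefficients sum to zero, the multiple of the fixed monomial `m₀` can be subtracted.
  have hsub : ∑ m ∈ S, MvPowerSeries.monomial m (MvPowerSeries.coeff m f) =
      ∑ m ∈ S, MvPowerSeries.coeff m f •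
        (MvPowerSeries.monomial m (1 : k) - MvPowerSeries.monomial m₀ 1) := by
    simp only [smul_sub, Finset.sum_sub_distrib]
    rw [← Finset.sum_smul, hsum, zero_smul, sub_zero]
    refine Finset.sum_congr rfl fun m _ => ?_
    rw [← map_smul, smul_eq_mul, mul_one]
  rw [hsub]
  refine Ideal.sum_mem _ fun m hm => ?_
  rw [MvPowerSeries.smul_eq_C_mul]
  exact Ideal.mul_mem_left _ _ (hmon _ _ (((hmemS m).mp hm).trans ((hmemS m₀).mp hm₀).symm))

/-! ### Normal forms of monomials -/

/-- The exponent vector `(a, b, c)` of a monomial `x ^ a y ^ b z ^ c` in normal form: `b ≤ s`,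
`c ≤ q`, and at most one of `y` and `z` occurs. The exponent of `x` is unrestricted, so it is not
an argument. -/
def IsNormal (s q b c : ℕ) : Prop := b ≤ s ∧ c ≤ q ∧ (b = 0 ∨ c = 0)

/-- A normal form is determined by its weight: the weight is `(d + 1) (a + b + 2 c) + (b - c)`,
and `b - c` lies in `[-q, s]`, an interval of length `d`. -/
theorem IsNormal.eq_of_weight_eq {d s q : ℕ} (hsq : s + q = d) {a b c a' b' c' : ℕ}
    (h : IsNormal s q b c) (h' : IsNormal s q b' c')
    (hw : a * (d + 1) + b * (d + 2) + c * (2 * d + 1) =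
      a' * (d + 1) + b' * (d + 2) + c' * (2 * d + 1)) :
    a = a' ∧ b = b' ∧ c = c' := by
  obtain ⟨hb, hc, hbc⟩ := h
  obtain ⟨hb', hc', hbc'⟩ := h'
  have hd : ((b : ℤ) - c) - (b' - c') = 0 := by
    refine Int.eq_zero_of_abs_lt_dvd (m := (d : ℤ) + 1) ?_ ?_
    · refine ⟨(a' + b' + 2 * c') - (a + b + 2 * c), ?_⟩
      have hw' : ((a * (d + 1) + b * (d + 2) + c * (2 * d + 1) : ℕ) : ℤ) =
        (a' * (d + 1) + b' * (d + 2) + c' * (2 * d + 1) : ℕ) := congrArg _ hw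
      push_cast at hw'
      linear_combination hw'
    · rw [abs_lt]
      omega
  obtain rfl : b = b' := by omega
  obtain rfl : c = c' := by omega
  have : a * (d + 1) = a' * (d + 1) := by omega
  exact ⟨Nat.eq_of_mul_eq_mul_right d.succ_pos this, rfl, rfl⟩

/-- The weights of the two sides of `y ^ (s + 1) - x ^ α z ^ q` agree. -/
theorem weight_relation_y {d s q α : ℕ} (hs : 3 * s + 2 = α + 2 * d) (hsq : s + q = d) :
    (s + 1) * (d + 2) = α * (d + 1) + q * (2 * d + 1) := by
  subst hsq
  zify at hs ⊢
  linear_combination ((s : ℤ) + q + 1) * hs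

/-- The weights of the two sides of `z ^ (q + 1) - x ^ β y ^ s` agree. -/
theorem weight_relation_z {d s q α β : ℕ} (hαβ : α + β = 3) (hs : 3 * s + 2 = α + 2 * d)
    (hsq : s + q = d) :
    (q + 1) * (2 * d + 1) = β * (d + 1) + s * (d + 2) := by
  subst hsq
  zify at hs hαβ ⊢
  linear_combination (-(s : ℤ) - q - 1) * hs - ((s : ℤ) + q + 1) * hαβ

/-- Rewriting by `y z → x ^ 3`, `y ^ (s + 1) → x ^ α z ^ q` and `z ^ (q + 1) → x ^ β y ^ s`
terminates in a normal form: a property of exponent vectors preserved by these rules and holding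
somewhere holds at some normal form. -/
theorem IsNormal.of_rewriting {d s q α β : ℕ} (hαβ : α + β = 3) (hs : 3 * s + 2 = α + 2 * d)
    (hsq : s + q = d) (hβ : 1 ≤ β) {C : ℕ → ℕ → ℕ → Prop}
    (h₁ : ∀ a b c, C a (b + 1) (c + 1) → C (a + 3) b c)
    (h₂ : ∀ a b c, C a (b + (s + 1)) c → C (a + α) b (c + q))
    (h₃ : ∀ a b c, C a b (c + (q + 1)) → C (a + β) (b + s) c)
    {a b c : ℕ} (h : C a b c) :
    ∃ a' b' c', IsNormal s q b' c' ∧ C a' b' c' := by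
  -- The weight of `y ^ b z ^ c` does not increase under the rules; adding `b` to it makes the
  -- measure drop also for the second rule with `α = 0`, which leaves that weight unchanged.
  -- The third rule adds `s < d + 1` to `b`, but lowers the weight by `β (d + 1)`.
  induction hM : b * (d + 3) + c * (2 * d + 1) using Nat.strong_induction_on
    generalizing a b c with
  | _ M ih =>
    subst hM
    have e₂ := weight_relation_y hs hsq
    have e₃ := weight_relation_z hαβ hs hsq
    by_cases hbs : s + 1 ≤ b
    · obtain ⟨b, rfl⟩ := Nat.exists_eq_add_of_le' hbs
      refine ih _ ?_ (h₂ _ _ _ h) rfl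
      nlinarith
    by_cases hcq : q + 1 ≤ c
    · obtain ⟨c, rfl⟩ := Nat.exists_eq_add_of_le' hcq
      refine ih _ ?_ (h₃ _ _ _ h) rfl
      have : 1 * (d + 1) ≤ β * (d + 1) := Nat.mul_le_mul_right _ hβ
      nlinarith
    by_cases hbc : b = 0 ∨ c = 0
    · exact ⟨a, b, c, ⟨by omega, by omega, hbc⟩, h⟩
    · push Not at hbc
      obtain ⟨b, rfl⟩ := Nat.exists_eq_add_one_of_ne_zero hbc.1
      obtain ⟨c, rfl⟩ := Nat.exists_eq_add_one_of_ne_zero hbc.2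
      refine ih _ ?_ (h₁ _ _ _ h) rfl
      nlinarith

/-! ### The Frobenius number -/

theorem mem_semigroup_gens {d N : ℕ} :
    N ∈ semigroup (gens d) ↔
      ∃ a b c, a * (d + 1) + b * (d + 2) + c * (2 * d + 1) = N := by
  rw [semigroup, AddSubmonoid.mem_closure_range_iff_of_fintype]
  constructor
  · rintro ⟨a, rfl⟩
    exact ⟨a 0, a 1, a 2, by simp [Fin.sum_univ_three, gens]⟩
  · rintro ⟨a, b, c, rfl⟩
    exact ⟨![a, b, c], by simp [Fin.sum_univ_three, gens]⟩

/-- The Frobenius number of `⟨d + 1, d + 2, 2 d + 1⟩` is the maximum of the Apéry set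
`{b (d + 2) | b ≤ s} ∪ {c (2 d + 1) | c ≤ q}` minus `d + 1`. -/
theorem frobeniusNumber_gens {d s q α β : ℕ} (hαβ : α + β = 3) (hs : 3 * s + 2 = α + 2 * d)
    (hsq : s + q = d) (hβ : 1 ≤ β) {F : ℕ}
    (hF : F + (d + 1) = max (s * (d + 2)) (q * (2 * d + 1))) :
    FrobeniusNumber F (Set.range (gens d)) := by
  rw [frobeniusNumber_iff]
  change F ∉ semigroup (gens d) ∧ ∀ N > F, N ∈ semigroup (gens d)
  have e₂ := weight_relation_y hs hsq
  have e₃ := weight_relation_z hαβ hs hsq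
  constructor
  · intro h
    obtain ⟨a₀, b₀, c₀, h₀⟩ := mem_semigroup_gens.mp h
    obtain ⟨a, b, c, hn, hw⟩ := IsNormal.of_rewriting hαβ hs hsq hβ
      (C := fun a b c => a * (d + 1) + b * (d + 2) + c * (2 * d + 1) = F)
      (fun a b c h => by rw [← h]; ring) (fun a b c h => by rw [← h]; linarith)
      (fun a b c h => by rw [← h]; linarith) h₀
    -- `F + (d + 1)` would have two normal forms, with `x`-exponents `a + 1` and `0`.
    rcases max_choice (s * (d + 2)) (q * (2 * d + 1)) with hm | hm
    · have := (hn.eq_of_weight_eq hsq (a := a + 1) (a' := 0) (b' := s) (c' := 0)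
        ⟨le_rfl, Nat.zero_le _, Or.inr rfl⟩ (by linarith)).1
      omega
    · have := (hn.eq_of_weight_eq hsq (a := a + 1) (a' := 0) (b' := 0) (c' := q)
        ⟨Nat.zero_le _, le_rfl, Or.inl rfl⟩ (by linarith)).1
      omega
  · intro N hN
    rw [mem_semigroup_gens]
    have hdiv := Nat.div_add_mod N (d + 1)
    have hr : N % (d + 1) < d + 1 := Nat.mod_lt _ d.succ_pos
    set r := N % (d + 1)
    set u := N / (d + 1)
    have hmax₁ := le_max_left (s * (d + 2)) (q * (2 * d + 1))
    have hmax₂ := le_max_right (s * (d + 2)) (q * (2 * d + 1))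
    -- The Apéry element `r (d + 2)` in the residue class of `N` is at most `F + (d + 1)`, hence
    -- at most `N`, as `N > F`.
    by_cases hrs : r ≤ s
    · have hle : r * (d + 2) ≤ s * (d + 2) := Nat.mul_le_mul_right _ hrs
      have hu : r ≤ u := by
        by_contra hlt
        have : (u + 1) * (d + 1) ≤ r * (d + 1) := Nat.mul_le_mul_right _ (by omega)
        nlinarith
      obtain ⟨a, ha⟩ := Nat.exists_eq_add_of_le hu
      refine ⟨a, r, 0, ?_⟩
      rw [← hdiv, ha]
      ring
    · -- The residue `r > s` is the one of `c (2 d + 1)` with `c = d + 1 - r ≤ q`.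
      obtain ⟨c, hc⟩ := Nat.exists_eq_add_of_le hr.le
      have hle : c * (2 * d + 1) ≤ q * (2 * d + 1) := Nat.mul_le_mul_right _ (by omega)
      have hu : 2 * c ≤ u + 1 := by
        by_contra hlt
        have : (u + 2) * (d + 1) ≤ (2 * c) * (d + 1) := Nat.mul_le_mul_right _ (by omega)
        nlinarith
      obtain ⟨a, ha⟩ := Nat.exists_eq_add_of_le hu
      refine ⟨a, 0, c, ?_⟩
      zify at ha hc hdiv ⊢
      linear_combination hdiv - ((d : ℤ) + 1) * ha + hc

/-! ### The ideal of minors -/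

theorem minorIdeal_two_eq_span {A : Type*} [CommRing A] (M : Matrix (Fin 2) (Fin 3) A) :
    minorIdeal 2 M = Ideal.span (Set.range ![M 0 0 * M 1 1 - M 0 1 * M 1 0,
      M 0 0 * M 1 2 - M 0 2 * M 1 0, M 0 1 * M 1 2 - M 0 2 * M 1 1]) := by
  rw [minorIdeal]
  congr 1
  ext f
  constructor
  · rintro ⟨r, c, rfl⟩
    have hr : r 0 < r 1 := r.strictMono Fin.zero_lt_one
    have hc : c 0 < c 1 := c.strictMono Fin.zero_lt_one
    rw [Matrix.det_fin_two]
    simp only [Matrix.submatrix_apply]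
    generalize r 0 = r₀ at *
    generalize r 1 = r₁ at *
    generalize c 0 = c₀ at *
    generalize c 1 = c₁ at *
    obtain ⟨rfl, rfl⟩ : r₀ = 0 ∧ r₁ = 1 := by omega
    obtain ⟨rfl, rfl⟩ | ⟨rfl, rfl⟩ | ⟨rfl, rfl⟩ :
        (c₀ = 0 ∧ c₁ = 1) ∨ (c₀ = 0 ∧ c₁ = 2) ∨ (c₀ = 1 ∧ c₁ = 2) := by omega
    · exact ⟨0, rfl⟩
    · exact ⟨1, rfl⟩
    · exact ⟨2, rfl⟩
  · have key : ∀ c₀ c₁ : Fin 3, c₀ < c₁ → ∃ (r : Fin 2 ↪o Fin 2) (c : Fin 2 ↪o Fin 3),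
        M 0 c₀ * M 1 c₁ - M 0 c₁ * M 1 c₀ = (M.submatrix r c).det := fun c₀ c₁ h =>
      ⟨RelEmbedding.refl _, OrderEmbedding.ofStrictMono ![c₀, c₁] (by
        intro i j hij
        obtain ⟨rfl, rfl⟩ : i = 0 ∧ j = 1 := by omega
        exact h), by rw [Matrix.det_fin_two]; rfl⟩
    rintro ⟨i, rfl⟩
    fin_cases i
    · exact key 0 1 (by decide)
    · exact key 0 2 (by decide)
    · exact key 1 2 (by decide)

theorem monomial_eq_x_y_z (k : Type*) [Field k] (m : Fin 3 →₀ ℕ) :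
    MvPowerSeries.monomial m (1 : k) = x k ^ m 0 * y k ^ m 1 * z k ^ m 2 := by
  simp only [x, y, z, MvPowerSeries.X_pow_eq, MvPowerSeries.monomial_mul_monomial, mul_one]
  refine congrArg (fun m => MvPowerSeries.monomial m (1 : k)) ?_
  ext i
  fin_cases i <;> simp

theorem weight_gens (d : ℕ) (m : Fin 3 →₀ ℕ) :
    Finsupp.weight (gens d) m = m 0 * (d + 1) + m 1 * (d + 2) + m 2 * (2 * d + 1) := by
  rw [Finsupp.weight_apply, Finsupp.sum_fintype (h := by simp), Fin.sum_univ_three]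
  simp [gens]

theorem isWeightedHomogeneous_x_y_z (k : Type*) [Field k] (d a b c : ℕ) :
    (x k ^ a * y k ^ b * z k ^ c).IsWeightedHomogeneous (gens d)
      (a * (d + 1) + b * (d + 2) + c * (2 * d + 1)) := by
  classical
  let m : Fin 3 →₀ ℕ := Finsupp.equivFunOnFinite.symm ![a, b, c]
  have hm : x k ^ a * y k ^ b * z k ^ c = MvPowerSeries.monomial m (1 : k) :=
    (monomial_eq_x_y_z k m).symm
  intro m' hm'
  rw [hm] at hm'
  rw [MvPowerSeries.eq_of_coeff_monomial_ne_zero hm', weight_gens]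
  rfl

theorem presentation_x_y_z (k : Type*) [Field k] (d a b c : ℕ) :
    (presentation k (gens d) (gens_pos d) (x k ^ a * y k ^ b * z k ^ c) : k⟦X⟧) =
      PowerSeries.X ^ (a * (d + 1) + b * (d + 2) + c * (2 * d + 1)) := by
  simp only [map_mul, map_pow, MulMemClass.coe_mul, SubmonoidClass.coe_pow, x, y, z,
    presentation_X, ← pow_mul, ← pow_add]
  simp [gens, mul_comm]

theorem isWeightedHomogeneous_sub (k : Type*) [Field k] {d a b c a' b' c' N : ℕ}
    (h : a * (d + 1) + b * (d + 2) + c * (2 * d + 1) = N)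
    (h' : a' * (d + 1) + b' * (d + 2) + c' * (2 * d + 1) = N) :
    (x k ^ a * y k ^ b * z k ^ c - x k ^ a' * y k ^ b' * z k ^ c').IsWeightedHomogeneous
      (gens d) N := by
  intro m hm
  by_contra hN
  rw [map_sub, MvPowerSeries.IsWeightedHomogeneous.coeff_eq_zero
      (isWeightedHomogeneous_x_y_z k d a b c) (h.symm ▸ hN),
    MvPowerSeries.IsWeightedHomogeneous.coeff_eq_zero
      (isWeightedHomogeneous_x_y_z k d a' b' c') (h'.symm ▸ hN), sub_zero] at hm
  exact hm rfl

theorem sub_mem_definingIdeal (k : Type*) [Field k] {d a b c a' b' c' N : ℕ}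
    (h : a * (d + 1) + b * (d + 2) + c * (2 * d + 1) = N)
    (h' : a' * (d + 1) + b' * (d + 2) + c' * (2 * d + 1) = N) :
    x k ^ a * y k ^ b * z k ^ c - x k ^ a' * y k ^ b' * z k ^ c' ∈
      definingIdeal k (gens d) (gens_pos d) := by
  rw [definingIdeal, RingHom.mem_ker, map_sub, sub_eq_zero]
  apply Subtype.ext
  exact ((presentation_x_y_z k d a b c).trans (by rw [h, h'])).trans
    (presentation_x_y_z k d a' b' c').symm

/-- The defining ideal of `⟨d + 1, d + 2, 2 d + 1⟩` is generated by the maximal minors of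
`(y, z ^ q, x ^ β; x ^ α, y ^ s, z)`. -/
theorem definingIdeal_gens_eq_minorIdeal (k : Type*) [Field k] {d s q α β : ℕ} (hαβ : α + β = 3)
    (hs : 3 * s + 2 = α + 2 * d) (hsq : s + q = d) (hβ : 1 ≤ β) :
    definingIdeal k (gens d) (gens_pos d) =
      minorIdeal 2 !![y k, z k ^ q, x k ^ β; x k ^ α, y k ^ s, z k] := by
  have e₂ := weight_relation_y hs hsq
  have e₃ := weight_relation_z hαβ hs hsq
  let g : Fin 3 → MvPowerSeries (Fin 3) k :=
    ![x k ^ 0 * y k ^ (s + 1) * z k ^ 0 - x k ^ α * y k ^ 0 * z k ^ q,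
      x k ^ 0 * y k ^ 1 * z k ^ 1 - x k ^ 3 * y k ^ 0 * z k ^ 0,
      x k ^ 0 * y k ^ 0 * z k ^ (q + 1) - x k ^ β * y k ^ s * z k ^ 0]
  let D : Fin 3 → ℕ := ![(s + 1) * (d + 2), 3 * (d + 1), (q + 1) * (2 * d + 1)]
  have hJ : minorIdeal 2 !![y k, z k ^ q, x k ^ β; x k ^ α, y k ^ s, z k] =
      Ideal.span (Set.range g) := by
    rw [minorIdeal_two_eq_span]
    congr 2
    funext i
    fin_cases i
    · simp only [g, Fin.zero_eta, Matrix.cons_val_zero, Matrix.of_apply, Matrix.cons_val_one]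
      ring
    · simp [g, ← hαβ]
      ring
    · simp [g]
      ring
  rw [hJ]
  apply le_antisymm
  · refine definingIdeal_le_span_range k (gens d) (gens_pos d) (D := D) ?_ ?_
    · intro i
      fin_cases i
      · exact isWeightedHomogeneous_sub k (N := D 0) (by simp [D]) (by simp [D, e₂])
      · exact isWeightedHomogeneous_sub k (N := D 1) (by simp [D]; ring) (by simp [D])
      · exact isWeightedHomogeneous_sub k (N := D 2) (by simp [D]) (by simp [D, e₃])
    · have hgJ : ∀ i, g i ∈ Ideal.span (Set.range g) := fun i => Ideal.subset_span ⟨i, rfl⟩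
      set J := Ideal.span (Set.range g)
      have hnf : ∀ m : Fin 3 →₀ ℕ, ∃ a b c, IsNormal s q b c ∧
          a * (d + 1) + b * (d + 2) + c * (2 * d + 1) = Finsupp.weight (gens d) m ∧
          MvPowerSeries.monomial m (1 : k) - x k ^ a * y k ^ b * z k ^ c ∈ J := by
        intro m
        refine IsNormal.of_rewriting hαβ hs hsq hβ
          (C := fun a b c =>
            a * (d + 1) + b * (d + 2) + c * (2 * d + 1) = Finsupp.weight (gens d) m ∧
            MvPowerSeries.monomial m (1 : k) - x k ^ a * y k ^ b * z k ^ c ∈ J)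
          ?_ ?_ ?_ (a := m 0) (b := m 1) (c := m 2) ⟨(weight_gens d m).symm, ?_⟩
        · rintro a b c ⟨hw, h⟩
          refine ⟨by rw [← hw]; ring, ?_⟩
          convert J.add_mem h (J.mul_mem_left (x k ^ a * y k ^ b * z k ^ c) (hgJ 1)) using 1
          simp only [g, Matrix.cons_val_one, Matrix.cons_val_zero]
          ring
        · rintro a b c ⟨hw, h⟩
          refine ⟨by rw [← hw]; linarith, ?_⟩
          convert J.add_mem h (J.mul_mem_left (x k ^ a * y k ^ b * z k ^ c) (hgJ 0)) using 1
          simp only [g, Matrix.cons_val_zero]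
          ring
        · rintro a b c ⟨hw, h⟩
          refine ⟨by rw [← hw]; linarith, ?_⟩
          convert J.add_mem h (J.mul_mem_left (x k ^ a * y k ^ b * z k ^ c) (hgJ 2)) using 1
          simp only [g, Matrix.cons_val]
          ring
        · rw [monomial_eq_x_y_z, sub_self]
          exact J.zero_mem
      intro m m' hmm
      obtain ⟨a, b, c, hn, hw, h⟩ := hnf m
      obtain ⟨a', b', c', hn', hw', h'⟩ := hnf m'
      obtain ⟨rfl, rfl, rfl⟩ := hn.eq_of_weight_eq hsq hn' (hw.trans (hmm.trans hw'.symm))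
      simpa using J.sub_mem h h'
  · rw [Ideal.span_le]
    rintro _ ⟨i, rfl⟩
    fin_cases i
    · exact sub_mem_definingIdeal k (N := D 0) (by simp [D]) (by simp [D, e₂])
    · exact sub_mem_definingIdeal k (N := D 1) (by simp [D]; ring) (by simp [D])
    · exact sub_mem_definingIdeal k (N := D 2) (by simp [D]) (by simp [D, e₃])

end NumSemigroup

/-! ### The three residue classes of `d` modulo `3` -/

theorem mainTheorem8 {k : Type*} [Field k] (d : ℕ) (hd : 5 ≤ d) :
    (d ≡ 0 [MOD 3] →
      NumSemigroup.definingIdeal k (NumSemigroup.gens d) (NumSemigroup.gens_pos d) =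
        NumSemigroup.minorIdeal 2
          !![NumSemigroup.y k, NumSemigroup.z k ^ (d / 3), NumSemigroup.x k;
             NumSemigroup.x k ^ 2, NumSemigroup.y k ^ (2 * d / 3), NumSemigroup.z k] ∧
      ∃ F : ℕ, FrobeniusNumber F (Set.range (NumSemigroup.gens d)) ∧
        (F : ℚ) = 2 / 3 * (d : ℚ) ^ 2 + 1 / 3 * (d : ℚ) - 1) ∧
    (d ≡ 1 [MOD 3] →
      NumSemigroup.definingIdeal k (NumSemigroup.gens d) (NumSemigroup.gens_pos d) =
        NumSemigroup.minorIdeal 2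
          !![NumSemigroup.y k, NumSemigroup.z k ^ ((d + 2) / 3), NumSemigroup.x k ^ 3;
             1, NumSemigroup.y k ^ ((2 * d - 2) / 3), NumSemigroup.z k] ∧
      ∃ F : ℕ, FrobeniusNumber F (Set.range (NumSemigroup.gens d)) ∧
        (F : ℚ) = 2 / 3 * (d : ℚ) ^ 2 + 2 / 3 * (d : ℚ) - 1 / 3) ∧
    (d ≡ 2 [MOD 3] →
      NumSemigroup.definingIdeal k (NumSemigroup.gens d) (NumSemigroup.gens_pos d) =
        NumSemigroup.minorIdeal 2
          !![NumSemigroup.y k, NumSemigroup.z k ^ ((d + 1) / 3), NumSemigroup.x k ^ 2;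
             NumSemigroup.x k, NumSemigroup.y k ^ ((2 * d - 1) / 3), NumSemigroup.z k] ∧
      ∃ F : ℕ, FrobeniusNumber F (Set.range (NumSemigroup.gens d)) ∧
        (F : ℚ) = 2 / 3 * (d : ℚ) ^ 2 - 2 / 3) := by
  refine ⟨fun h => ?_, fun h => ?_, fun h => ?_⟩
  · obtain ⟨m, rfl⟩ : ∃ m, d = 3 * m := ⟨d / 3, by unfold Nat.ModEq at h; omega⟩
    have hq : 3 * m / 3 = m := by omega
    have hs : 2 * (3 * m) / 3 = 2 * m := by omega
    rw [hq, hs]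
    constructor
    · simpa only [pow_one] using NumSemigroup.definingIdeal_gens_eq_minorIdeal k (d := 3 * m)
        (s := 2 * m) (q := m) (α := 2) (β := 1) rfl (by ring) (by ring) le_rfl
    · obtain ⟨n, rfl⟩ : ∃ n, m = n + 1 := ⟨m - 1, by omega⟩
      refine ⟨6 * n ^ 2 + 13 * n + 6, NumSemigroup.frobeniusNumber_gens (s := 2 * (n + 1))
        (q := n + 1) (α := 2) (β := 1) rfl (by ring) (by ring) le_rfl ?_, ?_⟩
      · rw [max_eq_left (by nlinarith)]
        ring
      · push_cast
        ring
  · obtain ⟨m, rfl⟩ : ∃ m, d = 3 * m + 1 := ⟨d / 3, by unfold Nat.ModEq at h; omega⟩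
    have hq : (3 * m + 1 + 2) / 3 = m + 1 := by omega
    have hs : (2 * (3 * m + 1) - 2) / 3 = 2 * m := by omega
    rw [hq, hs]
    constructor
    · simpa only [pow_zero] using NumSemigroup.definingIdeal_gens_eq_minorIdeal k (d := 3 * m + 1)
        (s := 2 * m) (q := m + 1) (α := 0) (β := 3) rfl (by ring) (by ring) (by norm_num)
    · refine ⟨6 * m ^ 2 + 6 * m + 1, NumSemigroup.frobeniusNumber_gens (s := 2 * m)
        (q := m + 1) (α := 0) (β := 3) rfl (by ring) (by ring) (by norm_num) ?_, ?_⟩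
      · rw [max_eq_right (by nlinarith)]
        ring
      · push_cast
        ring
  · obtain ⟨m, rfl⟩ : ∃ m, d = 3 * m + 2 := ⟨d / 3, by unfold Nat.ModEq at h; omega⟩
    have hq : (3 * m + 2 + 1) / 3 = m + 1 := by omega
    have hs : (2 * (3 * m + 2) - 1) / 3 = 2 * m + 1 := by omega
    rw [hq, hs]
    constructor
    · simpa only [pow_one] using NumSemigroup.definingIdeal_gens_eq_minorIdeal k (d := 3 * m + 2)
        (s := 2 * m + 1) (q := m + 1) (α := 1) (β := 2) rfl (by ring) (by ring) (by norm_num)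
    · refine ⟨6 * m ^ 2 + 8 * m + 2, NumSemigroup.frobeniusNumber_gens (s := 2 * m + 1)
        (q := m + 1) (α := 1) (β := 2) rfl (by ring) (by ring) (by norm_num) ?_, ?_⟩
      · rw [max_eq_right (by nlinarith)]
        ring
      · push_cast
        ring
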